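/- Model. A set $A$ of $n$ actions contains a null action $\bot$; each $a\in A$ has a cost $c(a)\ge 0$ and a success probability $f(a)\in[0,1]$, with $c(\bot)=0$. The inspection cost function $v:2^A\to\mathbb{R}_{\ge 0}$ is normalized ($v(\emptyset)=0$) and monotone; it is XOS if there are finitely many additive functions $\gamma_1,\dots,\gamma_k:2^A\to\mathbb{R}_{\ge0}$ with $v(S)=\max_{\ell}\gamma_\ell(S)$ for all $S\subseteq A$. A randomized inspection scheme $(i,\alpha,p)$ consists of a suggested action $i\in A$, a contract $\alpha\in[0,1]$ and a probability distribution $p$ on $2^A$. The agent's utility from action $j$ is $\alpha f(i)-c(i)$ if $j=i$, and $\alpha f(j)\bigl(1-\sum_{S:\{i,j\}\cap S\ne\emptyset}p(S)\bigr)-c(j)$ if $j\neq i$. The scheme is incentive compatible if $j=i$ maximizes this utility, and it is optimal if it is incentive compatible and maximizes the principal's utility $(1-\alpha)f(i)-\sum_{S}p(S)v(S)$ among all incentive-compatible schemes. An algorithm is given $A,\bot,c,f$, and accesses $v$ only through adaptive value queries (given $S\subseteq A$, the answer is $v(S)$) and demand queries (given prices $q\in\mathbb{R}_{\ge0}^{A}$,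 the answer is some set $S$ that maximizes $v(S)-\sum_{j\in S}q_j$, with ties broken by the oracle in an arbitrary way). Its computational power is not restricted, and it may be randomized. Theorem. There is $n_0$ such that for all $n\ge n_0$ the following holds. Every algorithm that, for every instance $(A,c,f,v)$ with $|A|=n$ and an XOS inspection cost function $v$ and for every demand oracle for $v$, returns (almost surely, if it is randomized) an optimal randomized inspection scheme, uses at least $\left(\frac54\right)^n$ value or demand queries on some such instance (in expectation, if it is randomized). -/

import Mathlib

open scoped NNReal ENNReal

namespace Inspection

/-- The part of an instance that is handed to an algorithm explicitly: the null action, the costs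
and the success probabilities of the actions in `A`. -/
structure Setting (A : Type*) where
  bot : A
  c : A → ℝ
  f : A → ℝ
  c_nonneg : ∀ a, 0 ≤ c a
  c_bot : c bot = 0
  f_mem : ∀ a, f a ∈ Set.Icc (0 : ℝ) 1

/-- An instance `(A, c, f, v)`, with a normalized monotone inspection cost function `v`. -/
structure Instance (A : Type*) extends Setting A where
  v : Finset A → ℝ
  v_nonneg : ∀ S, 0 ≤ v S
  v_empty : v ∅ = 0
  v_mono : ∀ S T, S ⊆ T → v S ≤ v T

/-- A set function is additive if its value on a set is the sum of its values on the singletons. -/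
def Additive {A : Type*} (g : Finset A → ℝ) : Prop :=
  ∀ S, g S = ∑ i ∈ S, g {i}

/-- A set function is XOS if it is the pointwise maximum of finitely many nonnegative additive
set functions. -/
def XOS {A : Type*} (v : Finset A → ℝ) : Prop :=
  ∃ (k : ℕ) (g : Fin k → Finset A → ℝ),
    (∀ l, Additive (g l) ∧ ∀ S, 0 ≤ g l S) ∧
    ∀ S, IsGreatest (Set.range fun l => g l S) (v S)

section Model

variable {A : Type*} [Fintype A] [DecidableEq A]

/-- A randomized inspection scheme: a suggested action `i`, a contract `α`, and a probability
distribution `p` over the sets of actions that are inspected. -/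
structure Scheme (A : Type*) [Fintype A] where
  i : A
  α : ℝ
  p : Finset A → ℝ
  α_mem : α ∈ Set.Icc (0 : ℝ) 1
  p_mem : ∀ S, p S ∈ Set.Icc (0 : ℝ) 1
  p_sum : ∑ S : Finset A, p S = 1

/-- The probability that the inspected set contains the suggested action or the action `j`. -/
def Scheme.caught (s : Scheme A) (j : A) : ℝ :=
  ∑ S : Finset A with s.i ∈ S ∨ j ∈ S, s.p S

/-- The expected utility of the agent from taking action `j` under the scheme `s`. -/
def Setting.agentUtility (E : Setting A) (s : Scheme A) (j : A) : ℝ :=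
  if j = s.i then s.α * E.f j - E.c j
  else s.α * E.f j * (1 - s.caught j) - E.c j

/-- The expected utility of the principal under the scheme `s` if the agent takes action `j`. -/
def Instance.principalUtility (I : Instance A) (s : Scheme A) (j : A) : ℝ :=
  (if j = s.i then (1 - s.α) * I.f j
    else (1 - s.α * (1 - s.caught j)) * I.f j) - ∑ S : Finset A, s.p S * I.v S

/-- Incentive compatibility: the suggested action is a best response of the agent. -/
def Setting.IC (E : Setting A) (s : Scheme A) : Prop :=
  ∀ j, E.agentUtility s j ≤ E.agentUtility s s.i

/-- `s` is an optimal randomized (incentive-compatible) inspection scheme for `I`. -/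
def Instance.IsOptimal (I : Instance A) (s : Scheme A) : Prop :=
  I.IC s ∧ ∀ s' : Scheme A, I.IC s' →
    I.principalUtility s' s'.i ≤ I.principalUtility s s.i

/-- `D` is a demand oracle for `v`: at every vector of nonnegative prices it returns a set that
maximizes the value minus the total price (ties are broken arbitrarily). -/
def IsDemandOracle (v : Finset A → ℝ) (D : (A → ℝ≥0) → Finset A) : Prop :=
  ∀ (q : A → ℝ≥0) (S : Finset A),
    v S - ∑ j ∈ S, (q j : ℝ) ≤ v (D q) - ∑ j ∈ D q, (q j : ℝ)

/-- A query to the inspection cost function. -/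
inductive Query (A : Type*) where
  | value (S : Finset A) : Query A
  | demand (q : A → ℝ≥0) : Query A

/-- The answer to a query: a number for a value query, a set for a demand query. -/
inductive Answer (A : Type*) where
  | number (x : ℝ) : Answer A
  | bundle (S : Finset A) : Answer A

/-- What an algorithm does next: ask a further query, or stop and output a scheme. -/
inductive Move (A : Type*) [Fintype A] where
  | ask (q : Query A) : Move A
  | output (s : Scheme A) : Move A

/-- A deterministic adaptive query algorithm, without any restriction on its computational power:
from the null action, the costs, the success probabilities and the answers received so far, it
determines its next move. -/
def QueryAlgorithm (A : Type*) [Fintype A] : Type _ :=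
  Setting A → List (Answer A) → Move A

/-- The answers of the value oracle for `v` and of the demand oracle `D`. -/
def answer (v : Finset A → ℝ) (D : (A → ℝ≥0) → Finset A) : Query A → Answer A
  | .value S => .number (v S)
  | .demand q => .bundle (D q)

/-- The answers received within the first `t` moves of the algorithm on the instance `I` with
demand oracle `D`; the list does not change any more once the algorithm has stopped. -/
def QueryAlgorithm.history (alg : QueryAlgorithm A) (I : Instance A)
    (D : (A → ℝ≥0) → Finset A) : ℕ → List (Answer A)
  | 0 => []
  | t + 1 =>
    match alg I.toSetting (alg.history I D t) with
    | .ask q => alg.history I D t ++ [answer I.v D q]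
    | .output _ => alg.history I D t

/-- On the instance `I` with demand oracle `D` the algorithm outputs `s` after at most `t`
queries. -/
def QueryAlgorithm.OutputsWithin (alg : QueryAlgorithm A) (I : Instance A)
    (D : (A → ℝ≥0) → Finset A) (t : ℕ) (s : Scheme A) : Prop :=
  alg I.toSetting (alg.history I D t) = .output s

/-- The algorithm stops and returns an optimal scheme for `I`. -/
def QueryAlgorithm.Solves (alg : QueryAlgorithm A) (I : Instance A)
    (D : (A → ℝ≥0) → Finset A) : Prop :=
  ∃ t s, alg.OutputsWithin I D t s ∧ I.IsOptimal s

/-- The number of queries that the algorithm makes, `⊤` if it never stops. -/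
noncomputable def QueryAlgorithm.numQueries (alg : QueryAlgorithm A) (I : Instance A)
    (D : (A → ℝ≥0) → Finset A) : ℕ∞ :=
  ⨅ (t : ℕ) (_ : ∃ s, alg.OutputsWithin I D t s), (t : ℕ∞)

end Model

end Inspection

/-!
The lower bound hides a set `U` in the inspection cost function. Fix an action `i` worth
suggesting and let `e` be the null action. Up to scaling, a set that contains `i` is as expensive
as all other actions together, every other nonempty set `S` costs `|S| + 1`, and only `U`, which
contains `e` but not `i`, is cheaper by one (`hiddenCost`). Whatever `U` is, this function is XOS.

The costs and success probabilities are such that at the cheapest contract `e` has to be caught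
with probability one and every other action with probability `1/2`. Without the reduction at `U`,
every such distribution on sets that contain `e` but not `i` and that catches no action more often
than necessary has the same cost; with it, inspecting `U` and its complement (with `e` added and
`i` removed) with probability `1/2` each saves half a unit. As the linear bound
`sum_caught_le_hiddenCost` shows, the saving is at most the probability of `U`, so that an optimal
scheme inspects `U` with probability at least `1/2` (`half_le_of_isOptimal`). Hence a given scheme
is optimal for at most two hidden sets.

On the other hand, a query says little about `U`. A demand oracle for the function without a
reduction that returns a set other than `U` remains correct after the reduction at `U`, since that
reduction only lowers values (`exists_hidden_oracle`). So each query of the run without a reduction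
rules out at most one hidden set, and in fewer than `t` queries an algorithm solves at most `t + 2` of the
`2 ^ (n - 2)` instances (`QueryAlgorithm.card_fast_le`). Averaging over the hidden sets gives one
for which the expected number of queries is at least `2 ^ (n - 5)`, which exceeds `(5/4) ^ n` for
`n ≥ 8`.
-/

namespace Inspection

/-! ### XOS functions with one cheap set -/

section Cost

variable {A : Type*}

/-- If at every set some nonnegative additive minorant of `v` is tight, then `v` is XOS. -/
theorem xos_of_supported [Fintype A] {v : Finset A → ℝ}
    (h : ∀ S, ∃ w : A → ℝ, (∀ a, 0 ≤ w a) ∧ (∀ R, ∑ a ∈ R, w a ≤ v R) ∧ ∑ a ∈ S, w a = v S) :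
    XOS v := by
  classical
  choose w hw0 hwle hweq using h
  let E := Fintype.equivFin (Finset A)
  refine ⟨Fintype.card (Finset A), fun l R => ∑ a ∈ R, w (E.symm l) a, fun l => ⟨?_, ?_⟩, ?_⟩
  · intro S
    simp
  · intro S
    exact Finset.sum_nonneg fun a _ => hw0 _ a
  · intro S
    refine ⟨⟨E S, by simp [hweq]⟩, ?_⟩
    rintro _ ⟨l, rfl⟩
    exact hwle _ S

variable [Fintype A] [DecidableEq A]

/-- The inspection cost function, before scaling, with hidden cheap set `U`: a set that contains
the action `i` costs `|A|`, and every other nonempty set `S` costs `|S| + 1`, except that `U`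
costs only `|U|`. If `i ∈ U`, then there is no cheap set. -/
def hiddenCost (i : A) (U S : Finset A) : ℝ :=
  if i ∈ S then (Fintype.card A : ℝ)
  else if S = ∅ then 0
  else if S = U then (S.card : ℝ)
  else S.card + 1

theorem card_add_one_le_of_notMem {i : A} {S : Finset A} (h : i ∉ S) :
    (S.card : ℝ) + 1 ≤ Fintype.card A := by
  have := Finset.card_le_univ (insert i S)
  rw [Finset.card_insert_of_notMem h] at this
  exact_mod_cast this

theorem hiddenCost_supported (i : A) (U S : Finset A) :
    ∃ w : A → ℝ, (∀ a, 0 ≤ w a) ∧ (∀ R, ∑ a ∈ R, w a ≤ hiddenCost i U R) ∧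
      ∑ a ∈ S, w a = hiddenCost i U S := by
  have hnn : ∀ R, 0 ≤ hiddenCost i U R := fun R => by
    unfold hiddenCost; split_ifs <;> positivity
  by_cases hi : i ∈ S
  · refine ⟨fun a => if a = i then (Fintype.card A : ℝ) else 0, fun a => ?_, fun R => ?_, ?_⟩
    · dsimp only; split_ifs <;> positivity
    · rw [Finset.sum_ite_eq']
      split_ifs with h
      · simp [hiddenCost, h]
      · exact hnn R
    · simp [hiddenCost, hi]
  by_cases h0 : S = ∅
  · exact ⟨fun _ => 0, fun _ => le_rfl, fun R => by simpa using hnn R, by simp [hiddenCost, h0]⟩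
  have hinter : ∀ R, ∑ a ∈ R, (if a ∈ S then (1 : ℝ) else 0) = (R ∩ S).card := fun R => by
    rw [Finset.sum_boole, Finset.filter_mem_eq_inter]
  have hle : ∀ R : Finset A, ((R ∩ S).card : ℝ) ≤ R.card := fun R => by
    exact_mod_cast Finset.card_le_card Finset.inter_subset_left
  have hcard : ∀ R : Finset A, ((R ∩ S).card : ℝ) + 1 ≤ Fintype.card A := fun R =>
    card_add_one_le_of_notMem fun h => hi (Finset.mem_inter.1 h).2
  by_cases hU : S = U
  · refine ⟨fun a => if a ∈ S then 1 else 0, fun a => ?_, fun R => ?_, ?_⟩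
    · dsimp only; split_ifs <;> norm_num
    · rw [hinter]
      have h1 := hle R
      have h2 := hcard R
      unfold hiddenCost
      split_ifs with h3 h4
      · linarith
      · simp [h4]
      · exact h1
      · linarith
    · rw [hinter]
      simp [hiddenCost, hi, h0, hU.symm]
  -- An extra unit on `j` must not push the clause above the reduced cost of `U`: either `j ∉ U`,
  -- or the clause misses an element of `U`.
  obtain ⟨j, hjS, hj⟩ : ∃ j ∈ S, j ∉ U ∨ S ⊂ U := by
    by_cases hsub : S ⊆ U
    · obtain ⟨j, hj⟩ := Finset.nonempty_iff_ne_empty.2 h0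
      exact ⟨j, hj, Or.inr (hsub.ssubset_of_ne hU)⟩
    · obtain ⟨j, hj, hj'⟩ := Finset.not_subset.1 hsub
      exact ⟨j, hj, Or.inl hj'⟩
  have hsum : ∀ R, ∑ a ∈ R, ((if a ∈ S then (1 : ℝ) else 0) + if a = j then 1 else 0) =
      (R ∩ S).card + if j ∈ R then 1 else 0 := fun R => by
    rw [Finset.sum_add_distrib, hinter, Finset.sum_ite_eq']
  refine ⟨fun a => (if a ∈ S then 1 else 0) + if a = j then 1 else 0, fun a => ?_, fun R => ?_, ?_⟩
  · dsimp only; split_ifs <;> norm_num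
  · rw [hsum]
    have h1 := hle R
    have h2 := hcard R
    have h5 : (if j ∈ R then (1 : ℝ) else 0) ≤ 1 := by split_ifs <;> norm_num
    unfold hiddenCost
    split_ifs with h3 h6 h4 h7 h8 <;> try linarith
    · simp [h4] at h3
    · rcases hj with hj | hj
      · exact absurd (h7 ▸ h3) hj
      · subst h7
        have : (S.card : ℝ) + 1 ≤ R.card := by exact_mod_cast Finset.card_lt_card hj
        rwa [Finset.inter_eq_right.2 hj.subset]
    all_goals simp_all
  · rw [hsum]
    simp [hiddenCost, hi, h0, hU, hjS]

theorem hiddenCost_le_hiddenCost_univ (i : A) (U S : Finset A) :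
    hiddenCost i U S ≤ hiddenCost i Finset.univ S := by
  unfold hiddenCost
  split_ifs with h1 h2 h3 h4 h5 <;> first | linarith | simp_all

theorem hiddenCost_eq_of_ne {i : A} {U S : Finset A} (h : S ≠ U) :
    hiddenCost i U S = hiddenCost i Finset.univ S := by
  unfold hiddenCost
  split_ifs with h1 h2 h3 <;> simp_all

/-- Apart from the reduction at `U`, the cost of `S` is at least the number of actions that `S`
catches when `i` is suggested, with the action `e` counted twice. -/
theorem sum_caught_le_hiddenCost (e i : A) (U S : Finset A) :
    (∑ j ∈ Finset.univ.erase i, if i ∈ S ∨ j ∈ S then (1 : ℝ) else 0) +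
      (if i ∈ S ∨ e ∈ S then 1 else 0) - (if S = U then 1 else 0) ≤ hiddenCost i U S := by
  by_cases hi : i ∈ S
  · have h1 : (((Finset.univ.erase i).card : ℕ) : ℝ) + 1 ≤ Fintype.card A :=
      card_add_one_le_of_notMem (Finset.notMem_erase i _)
    have h2 : (0 : ℝ) ≤ if S = U then 1 else 0 := by split_ifs <;> norm_num
    simp only [hi, true_or, if_true, hiddenCost, Finset.sum_const, nsmul_eq_mul, mul_one]
    linarith
  · have h1 : ∑ j ∈ Finset.univ.erase i, (if j ∈ S then (1 : ℝ) else 0) = S.card := by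
      rw [Finset.sum_boole, Finset.filter_mem_eq_inter, Finset.inter_eq_right.2]
      exact fun x hx => Finset.mem_erase.2 ⟨fun h => hi (h ▸ hx), Finset.mem_univ _⟩
    simp only [hi, false_or, hiddenCost, if_false, h1]
    by_cases h0 : S = ∅
    · subst h0
      simp
      split_ifs <;> norm_num
    · simp only [h0, if_false]
      split_ifs <;> linarith

end Cost

/-! ### Optimal schemes of the hard instances -/

section Instances

variable {A : Type*} [Fintype A] [DecidableEq A]

/-- The costs and success probabilities of the hard instances. At the least contract `1/2` that
makes `i` worth its cost, incentive compatibility forces the null action `e` to be caught with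
probability one and every other action with probability `1/2`. -/
noncomputable def hardSetting (e i : A) (h : e ≠ i) : Setting A where
  bot := e
  c j := if j = i then 1 / 2 else if j = e then 0 else 1 / 16
  f j := if j = i then 1 else 1 / 4
  c_nonneg j := by split_ifs <;> norm_num
  c_bot := by simp [h]
  f_mem j := by split_ifs <;> norm_num

/-- The hard instance with hidden cheap set `U`. The costs are scaled down so far that raising the
contract above `1/2` costs the principal more than it saves in inspections. -/
noncomputable def hardInstance (e i : A) (h : e ≠ i) (U : Finset A) : Instance A where
  toSetting := hardSetting e i h
  v S := hiddenCost i U S / (16 * Fintype.card A)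
  v_nonneg S := by
    unfold hiddenCost; split_ifs <;> positivity
  v_empty := by simp [hiddenCost]
  v_mono S R hSR := by
    obtain ⟨w, hw0, hwle, hweq⟩ := hiddenCost_supported i U S
    have : hiddenCost i U S ≤ hiddenCost i U R :=
      hweq ▸ (Finset.sum_le_sum_of_subset_of_nonneg hSR fun a _ _ => hw0 a).trans (hwle R)
    gcongr

theorem hardInstance_xos (e i : A) (h : e ≠ i) (U : Finset A) : XOS (hardInstance e i h U).v := by
  refine xos_of_supported fun S => ?_
  obtain ⟨w, hw0, hwle, hweq⟩ := hiddenCost_supported i U S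
  refine ⟨fun a => w a / (16 * Fintype.card A), fun a => div_nonneg (hw0 a) (by positivity),
    fun R => ?_, ?_⟩
  · rw [← Finset.sum_div]
    exact div_le_div_of_nonneg_right (hwle R) (by positivity)
  · rw [← Finset.sum_div, hweq]
    rfl

/-- The scheme that suggests `i` with contract `1/2` and inspects, with probability `1/2` each, the
set `U` and the set of all actions outside `U` other than `i`, together with `e`. -/
noncomputable def splitScheme (e i : A) (U : Finset A) : Scheme A where
  i := i
  α := 1 / 2
  p S := (if S = U then 1 / 2 else 0) + if S = insert e (Uᶜ.erase i) then 1 / 2 else 0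
  α_mem := by norm_num
  p_mem S := by split_ifs <;> norm_num
  p_sum := by
    rw [Finset.sum_add_distrib]
    simp
    norm_num

theorem splitScheme_expectation (e i : A) (U : Finset A) (g : Finset A → ℝ) :
    ∑ S, (splitScheme e i U).p S * g S = (g U + g (insert e (Uᶜ.erase i))) / 2 := by
  simp only [splitScheme, add_mul, Finset.sum_add_distrib, ite_mul, zero_mul, Finset.sum_ite_eq',
    Finset.mem_univ, if_true]
  ring

theorem Scheme.caught_eq (s : Scheme A) (j : A) :
    s.caught j = ∑ S, s.p S * if s.i ∈ S ∨ j ∈ S then 1 else 0 := by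
  rw [Scheme.caught, Finset.sum_filter]
  simp

theorem Scheme.caught_le_one (s : Scheme A) (j : A) : s.caught j ≤ 1 := by
  rw [← s.p_sum, Scheme.caught]
  exact Finset.sum_le_sum_of_subset_of_nonneg (Finset.filter_subset _ _) fun S _ _ => (s.p_mem S).1

theorem splitScheme_ic {e i : A} (h : e ≠ i) {U : Finset A} (he : e ∈ U) :
    (hardSetting e i h).IC (splitScheme e i U) := by
  have hI : (splitScheme e i U).i = i := rfl
  have hα : (splitScheme e i U).α = 1 / 2 := rfl
  intro j
  by_cases hj : j = i
  · rw [hj, hI]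
  have hcaught := (splitScheme e i U).caught_eq j
  rw [splitScheme_expectation, hI] at hcaught
  simp only [Setting.agentUtility, hI, hα, hj, hardSetting, if_true, if_false]
  by_cases hje : j = e
  · subst hje
    simp only [he, Finset.mem_insert_self, or_true, if_true] at hcaught
    rw [hcaught]
    norm_num
  · have h1 : (1 : ℝ) / 2 ≤ (splitScheme e i U).caught j := by
      rw [hcaught]
      by_cases hjU : j ∈ U
      · have : (0 : ℝ) ≤ if i ∈ insert e (Uᶜ.erase i) ∨ j ∈ insert e (Uᶜ.erase i)
            then 1 else 0 := by split_ifs <;> norm_num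
        simp only [hjU, or_true, if_true]
        linarith
      · have h2 : j ∈ insert e (Uᶜ.erase i) := by simp [hj, hjU]
        have : (0 : ℝ) ≤ if i ∈ U ∨ j ∈ U then 1 else 0 := by split_ifs <;> norm_num
        simp only [h2, or_true, if_true]
        linarith
    simp only [hje, if_false]
    linarith

theorem le_principalUtility_splitScheme {e i : A} (h : e ≠ i) {U : Finset A} (he : e ∈ U)
    (hi : i ∉ U) :
    1 / 2 - ((Fintype.card A : ℝ) + 1) / 2 / (16 * Fintype.card A) ≤
      (hardInstance e i h U).principalUtility (splitScheme e i U) (splitScheme e i U).i := by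
  set V := insert e (Uᶜ.erase i) with hV
  have hU0 : U ≠ ∅ := Finset.ne_empty_of_mem he
  have hiV : i ∉ V := by simp [hV, h.symm]
  have h1 : hiddenCost i U U = U.card := by simp [hiddenCost, hi, hU0]
  have h2 : hiddenCost i U V ≤ V.card + 1 := by
    simp only [hiddenCost, hiV, if_false]
    split_ifs <;> first | positivity | linarith
  have h3 : (U.card : ℝ) + V.card = Fintype.card A := by
    have h4 : V.card = (Uᶜ.erase i).card + 1 := Finset.card_insert_of_notMem (by simp [he])
    have h5 : (Uᶜ.erase i).card + 1 = Uᶜ.card := Finset.card_erase_add_one (by simpa using hi)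
    have h6 := Finset.card_add_card_compl U
    exact_mod_cast (by omega : U.card + V.card = Fintype.card A)
  rw [Instance.principalUtility, splitScheme_expectation, if_pos rfl]
  have h4 : (hardInstance e i h U).f (splitScheme e i U).i = 1 := by
    simp [hardInstance, hardSetting, splitScheme]
  have h5 : (splitScheme e i U).α = 1 / 2 := rfl
  have h6 : ((hardInstance e i h U).v U + (hardInstance e i h U).v V) / 2 ≤
      ((Fintype.card A : ℝ) + 1) / 2 / (16 * Fintype.card A) := by
    have : ((hardInstance e i h U).v U + (hardInstance e i h U).v V) / 2 =
        (hiddenCost i U U + hiddenCost i U V) / 2 / (16 * Fintype.card A) := by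
      simp only [hardInstance]; ring
    rw [this]
    gcongr ?_ / 2 / _
    linarith
  rw [h4, h5]
  linarith

/-- The expected cost of a scheme that suggests `i` is bounded below by its catching
probabilities. -/
theorem Scheme.sum_caught_le_cost (e : A) {i : A} (U : Finset A) (s : Scheme A)
    (hs : s.i = i) :
    (∑ j ∈ Finset.univ.erase i, s.caught j) + s.caught e - s.p U ≤
      ∑ S, s.p S * hiddenCost i U S := by
  calc (∑ j ∈ Finset.univ.erase i, s.caught j) + s.caught e - s.p U
      = ∑ S, s.p S * ((∑ j ∈ Finset.univ.erase i, if i ∈ S ∨ j ∈ S then (1 : ℝ) else 0) +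
          (if i ∈ S ∨ e ∈ S then 1 else 0) - (if S = U then 1 else 0)) := by
        simp only [Scheme.caught_eq, hs, mul_sub, mul_add, Finset.sum_sub_distrib,
          Finset.sum_add_distrib, Finset.mul_sum]
        rw [Finset.sum_comm]
        simp
    _ ≤ _ := Finset.sum_le_sum fun S _ =>
        mul_le_mul_of_nonneg_left (sum_caught_le_hiddenCost e i U S) (s.p_mem S).1

/-- An optimal scheme inspects the hidden set with probability at least `1/2`. -/
theorem half_le_of_isOptimal {e i : A} (h : e ≠ i) {U : Finset A} (he : e ∈ U) (hi : i ∉ U)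
    {s : Scheme A} (hs : (hardInstance e i h U).IsOptimal s) : 1 / 2 ≤ s.p U := by
  have hn : (2 : ℝ) ≤ Fintype.card A := by
    have := card_add_one_le_of_notMem (i := i) (S := {e}) (by simpa using h.symm)
    simp at this
    linarith
  have hopt := (le_principalUtility_splitScheme h he hi).trans (hs.2 _ (splitScheme_ic h he))
  have hα0 := s.α_mem.1
  rw [Instance.principalUtility, if_pos rfl] at hopt
  by_cases hsi : s.i = i
  · have hic := hs.1
    have hf : (hardInstance e i h U).f s.i = 1 := by simp [hardInstance, hardSetting, hsi]
    have hv : ∑ S, s.p S * (hardInstance e i h U).v S =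
        (∑ S, s.p S * hiddenCost i U S) / (16 * Fintype.card A) := by
      simp only [hardInstance, Finset.sum_div, mul_div_assoc]
    have hce : s.α / 4 * (1 - s.caught e) ≤ s.α - 1 / 2 := by
      have := hic e
      simp [Setting.agentUtility, hardInstance, hardSetting, hsi, h] at this
      linarith
    have hce1 := s.caught_le_one e
    have hα : 1 / 2 ≤ s.α := by
      have : 0 ≤ s.α / 4 * (1 - s.caught e) := mul_nonneg (by linarith) (by linarith)
      linarith
    have hce2 : 1 - 8 * (s.α - 1 / 2) ≤ s.caught e := by nlinarith
    have hcj : ∀ j ∈ (Finset.univ.erase i).erase e,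
        1 / 2 - 7 * (s.α - 1 / 2) ≤ s.caught j := by
      intro j hj
      simp only [Finset.mem_erase, Finset.mem_univ, and_true] at hj
      have := hic j
      simp [Setting.agentUtility, hardInstance, hardSetting, hsi, hj.1, hj.2] at this
      by_contra! hlt
      nlinarith [mul_nonneg (sub_nonneg.2 hα) (sub_nonneg.2 hα)]
    have hmem : e ∈ (Finset.univ : Finset A).erase i := by simp [h]
    have hcard : ((((Finset.univ : Finset A).erase i).erase e).card : ℝ) =
        Fintype.card A - 2 := by
      have h1 := Finset.card_erase_add_one hmem
      have h2 := Finset.card_erase_add_one (Finset.mem_univ i)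
      rw [Finset.card_univ] at h2
      rw [← h2, ← h1]
      push_cast
      ring
    have hsum := Finset.card_nsmul_le_sum _ _ _ hcj
    rw [nsmul_eq_mul, hcard] at hsum
    have hcost := s.sum_caught_le_cost e U hsi
    rw [← Finset.sum_erase_add _ _ hmem] at hcost
    have hcost' : (Fintype.card A : ℝ) / 2 + 1 - 8 * Fintype.card A * (s.α - 1 / 2) - s.p U ≤
        ∑ S, s.p S * hiddenCost i U S := by nlinarith
    have hdiv := div_le_div_of_nonneg_right hcost'
      (by positivity : (0 : ℝ) ≤ 16 * Fintype.card A)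
    rw [hf, hv] at hopt
    have hfin : ((Fintype.card A : ℝ) / 2 + 1 - 8 * Fintype.card A * (s.α - 1 / 2) - s.p U) /
        (16 * Fintype.card A) ≤ (1 / 2 - s.α) +
          ((Fintype.card A : ℝ) + 1) / 2 / (16 * Fintype.card A) := by linarith
    have hpos : (0 : ℝ) < 16 * Fintype.card A := by linarith
    rw [div_le_iff₀ hpos, add_mul, div_mul_cancel₀ _ hpos.ne'] at hfin
    nlinarith
  · -- Suggesting another action yields at most `1/4`, less than the splitting scheme does.
    exfalso
    have hf : (hardInstance e i h U).f s.i = 1 / 4 := by simp [hardInstance, hardSetting, hsi]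
    have hv : 0 ≤ ∑ S, s.p S * (hardInstance e i h U).v S :=
      Finset.sum_nonneg fun S _ => mul_nonneg (s.p_mem S).1 ((hardInstance e i h U).v_nonneg S)
    have h1 : ((Fintype.card A : ℝ) + 1) / 2 / (16 * Fintype.card A) ≤ 1 / 8 := by
      rw [div_le_iff₀ (by linarith)]
      linarith
    rw [hf] at hopt
    linarith

end Instances

/-! ### Runs, oracles, and indistinguishability -/

section Oracles

variable {A : Type*} [Fintype A]

theorem Scheme.card_half_le_le_two (s : Scheme A) :
    (Finset.univ.filter fun U => (1 : ℝ) / 2 ≤ s.p U).card ≤ 2 := by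
  have h1 := Finset.card_nsmul_le_sum (Finset.univ.filter fun U => (1 : ℝ) / 2 ≤ s.p U) s.p (1 / 2)
    fun U hU => (Finset.mem_filter.1 hU).2
  have h2 : ∑ U ∈ Finset.univ.filter (fun U => (1 : ℝ) / 2 ≤ s.p U), s.p U ≤ 1 := by
    rw [← s.p_sum]
    exact Finset.sum_le_sum_of_subset_of_nonneg (Finset.filter_subset _ _) fun S _ _ => (s.p_mem S).1
  rw [nsmul_eq_mul] at h1
  have h3 : ((Finset.univ.filter fun U => (1 : ℝ) / 2 ≤ s.p U).card : ℝ) ≤ 2 := by linarith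
  exact_mod_cast h3

theorem exists_isDemandOracle (v : Finset A → ℝ) : ∃ D, IsDemandOracle v D := by
  have : ∀ q : A → ℝ≥0, ∃ R : Finset A, ∀ S,
      v S - ∑ j ∈ S, (q j : ℝ) ≤ v R - ∑ j ∈ R, (q j : ℝ) :=
    fun q => Finite.exists_max fun S => v S - ∑ j ∈ S, (q j : ℝ)
  choose D hD using this
  exact ⟨D, hD⟩

theorem QueryAlgorithm.OutputsWithin.mono {alg : QueryAlgorithm A} {I : Instance A}
    {D : (A → ℝ≥0) → Finset A} {t t' : ℕ} {s : Scheme A} (h : alg.OutputsWithin I D t s)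
    (ht : t ≤ t') : alg.OutputsWithin I D t' s := by
  induction ht with
  | refl => exact h
  | step _ ih =>
    unfold OutputsWithin at ih ⊢
    rw [history, ih]
    exact ih

theorem QueryAlgorithm.OutputsWithin.unique {alg : QueryAlgorithm A} {I : Instance A}
    {D : (A → ℝ≥0) → Finset A} {t t' : ℕ} {s s' : Scheme A} (h : alg.OutputsWithin I D t s)
    (h' : alg.OutputsWithin I D t' s') : s = s' := by
  have h1 := h.mono (le_max_left t t')
  have h2 := h'.mono (le_max_right t t')
  unfold OutputsWithin at h1 h2
  rw [h1] at h2
  exact Move.output.inj h2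

theorem QueryAlgorithm.exists_outputsWithin_of_numQueries_lt (alg : QueryAlgorithm A) {I : Instance A}
    {D : (A → ℝ≥0) → Finset A} {t : ℕ} (h : alg.numQueries I D < t) :
    ∃ s, alg.OutputsWithin I D t s := by
  simp only [numQueries, iInf_lt_iff] at h
  obtain ⟨t', ⟨s, hs⟩, ht'⟩ := h
  exact ⟨s, hs.mono (Nat.cast_le.1 ht'.le)⟩

variable [DecidableEq A]

/-- The only hidden set that a query can detect, if the answers otherwise follow the oracle `D`:
the queried set, or the set returned by `D`. -/
def Query.touched (D : (A → ℝ≥0) → Finset A) : Query A → Finset A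
  | .value S => S
  | .demand q => D q

/-- Lowering the cost of a single set `U` does not affect the demand at prices at which the
original oracle returned a set other than `U`. -/
theorem exists_hidden_oracle (e i : A) (h : e ≠ i) {D₀ : (A → ℝ≥0) → Finset A}
    (hD₀ : IsDemandOracle (hardInstance e i h Finset.univ).v D₀) (U : Finset A) :
    ∃ D, IsDemandOracle (hardInstance e i h U).v D ∧
      ∀ q : Query A, q.touched D₀ ≠ U →
        answer (hardInstance e i h U).v D q = answer (hardInstance e i h Finset.univ).v D₀ q := by
  obtain ⟨D', hD'⟩ := exists_isDemandOracle (hardInstance e i h U).v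
  have hne : ∀ S, S ≠ U → (hardInstance e i h U).v S = (hardInstance e i h Finset.univ).v S :=
    fun S hS => by simp only [hardInstance, hiddenCost_eq_of_ne hS]
  have hle : ∀ S, (hardInstance e i h U).v S ≤ (hardInstance e i h Finset.univ).v S :=
    fun S => div_le_div_of_nonneg_right (hiddenCost_le_hiddenCost_univ i U S) (by positivity)
  refine ⟨fun q => if D₀ q = U then D' q else D₀ q, fun q S => ?_, fun q hq => ?_⟩
  · dsimp only
    split_ifs with hq
    · exact hD' q S
    · rw [hne _ hq]
      exact (sub_le_sub_right (hle S) _).trans (hD₀ q S)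
  · cases q with
    | value S => simp only [answer, hne S hq]
    | demand q => simp only [answer, if_neg (show ¬ D₀ q = U from hq)]

variable (alg : QueryAlgorithm A)

/-- The sets touched by the queries among the first `t` moves. -/
def QueryAlgorithm.touchedWithin (I : Instance A) (D : (A → ℝ≥0) → Finset A) :
    ℕ → Finset (Finset A)
  | 0 => ∅
  | t + 1 =>
    match alg I.toSetting (alg.history I D t) with
    | .ask q => insert (q.touched D) (QueryAlgorithm.touchedWithin I D t)
    | .output _ => QueryAlgorithm.touchedWithin I D t

theorem QueryAlgorithm.card_touchedWithin_le (I : Instance A) (D : (A → ℝ≥0) → Finset A) (t : ℕ) :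
    (alg.touchedWithin I D t).card ≤ t := by
  induction t with
  | zero => simp [touchedWithin]
  | succ t ih =>
    rw [touchedWithin]
    split
    · exact (Finset.card_insert_le _ _).trans (by omega)
    · omega

/-- Two instances whose oracles differ only at queries that touch `U` are not distinguished before
`U` is touched. -/
theorem QueryAlgorithm.history_eq_of_notMem {I I₀ : Instance A} {D D₀ : (A → ℝ≥0) → Finset A}
    {U : Finset A} (hE : I.toSetting = I₀.toSetting)
    (hq : ∀ q : Query A, q.touched D₀ ≠ U → answer I.v D q = answer I₀.v D₀ q) {t : ℕ}
    (hU : U ∉ alg.touchedWithin I₀ D₀ t) : alg.history I D t = alg.history I₀ D₀ t := by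
  induction t with
  | zero => rfl
  | succ t ih =>
    rw [touchedWithin] at hU
    rw [history, history, hE]
    cases hm : alg I₀.toSetting (alg.history I₀ D₀ t) with
    | ask q =>
      simp only [hm, Finset.mem_insert, not_or] at hU
      rw [ih hU.2, hm]
      simp only [hq q (Ne.symm hU.1)]
    | output s =>
      simp only [hm] at hU
      rw [ih hU, hm]

/-- In fewer than `t` queries an algorithm can be correct for at most `t + 2` hidden sets: those it
touches in the run without a hidden set, and the at most two that suit the output of that run. -/
theorem QueryAlgorithm.card_fast_le {e i : A} (h : e ≠ i) {D₀ : (A → ℝ≥0) → Finset A}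
    {D : Finset A → (A → ℝ≥0) → Finset A}
    (hD : ∀ U, ∀ q : Query A, q.touched D₀ ≠ U →
      answer (hardInstance e i h U).v (D U) q = answer (hardInstance e i h Finset.univ).v D₀ q)
    {F : Finset (Finset A)} (hF : ∀ U ∈ F, e ∈ U ∧ i ∉ U)
    (hs : ∀ U ∈ F, alg.Solves (hardInstance e i h U) (D U)) (t : ℕ) :
    (F.filter fun U => alg.numQueries (hardInstance e i h U) (D U) < t).card ≤ t + 2 := by
  set I₀ := hardInstance e i h Finset.univ with hI₀
  have key : ∀ U ∈ F, alg.numQueries (hardInstance e i h U) (D U) < t →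
      U ∉ alg.touchedWithin I₀ D₀ t → ∃ s, alg.OutputsWithin I₀ D₀ t s ∧ 1 / 2 ≤ s.p U := by
    intro U hUF hlt hU
    obtain ⟨s, hst⟩ := alg.exists_outputsWithin_of_numQueries_lt hlt
    obtain ⟨t', s', hs', hopt⟩ := hs U hUF
    obtain rfl := hst.unique hs'
    refine ⟨s, ?_, half_le_of_isOptimal h (hF U hUF).1 (hF U hUF).2 hopt⟩
    unfold OutputsWithin at hst ⊢
    rw [← alg.history_eq_of_notMem (I := hardInstance e i h U) (I₀ := I₀) rfl (hD U) hU]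
    exact hst
  have hT := alg.card_touchedWithin_le I₀ D₀ t
  by_cases hout : ∃ s, alg.OutputsWithin I₀ D₀ t s
  · obtain ⟨s, hst⟩ := hout
    calc _ ≤ (alg.touchedWithin I₀ D₀ t ∪
          Finset.univ.filter fun U => (1 : ℝ) / 2 ≤ s.p U).card := by
          refine Finset.card_le_card fun U hU => ?_
          obtain ⟨hUF, hlt⟩ := Finset.mem_filter.1 hU
          by_cases hUT : U ∈ alg.touchedWithin I₀ D₀ t
          · exact Finset.mem_union_left _ hUT
          · obtain ⟨s', hs', hp⟩ := key U hUF hlt hUT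
            obtain rfl := hst.unique hs'
            exact Finset.mem_union_right _ (Finset.mem_filter.2 ⟨Finset.mem_univ _, hp⟩)
      _ ≤ _ := (Finset.card_union_le _ _).trans (add_le_add hT (s.card_half_le_le_two))
  · refine (Finset.card_le_card fun U hU => ?_).trans (hT.trans (Nat.le_add_right t 2))
    obtain ⟨hUF, hlt⟩ := Finset.mem_filter.1 hU
    by_contra hUT
    obtain ⟨s, hs', -⟩ := key U hUF hlt hUT
    exact hout ⟨s, hs'⟩

/-- The total number of queries over all hidden sets is quadratic in their number. -/
theorem QueryAlgorithm.le_sum_numQueries {e i : A} (h : e ≠ i) {D₀ : (A → ℝ≥0) → Finset A}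
    {D : Finset A → (A → ℝ≥0) → Finset A}
    (hD : ∀ U, ∀ q : Query A, q.touched D₀ ≠ U →
      answer (hardInstance e i h U).v (D U) q = answer (hardInstance e i h Finset.univ).v D₀ q)
    {F : Finset (Finset A)} (hF : ∀ U ∈ F, e ∈ U ∧ i ∉ U)
    (hs : ∀ U ∈ F, alg.Solves (hardInstance e i h U) (D U)) {t : ℕ} (ht : 2 ≤ t)
    (hcard : F.card = 4 * t) :
    ((2 * t * t : ℕ) : ℝ≥0∞) ≤
      ∑ U ∈ F, ((alg.numQueries (hardInstance e i h U) (D U) : ℕ∞) : ℝ≥0∞) := by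
  have h1 := alg.card_fast_le h hD hF hs t
  have h2 := Finset.card_filter_add_card_filter_not (s := F)
    (fun U => alg.numQueries (hardInstance e i h U) (D U) < t)
  set G := F.filter fun U => ¬ alg.numQueries (hardInstance e i h U) (D U) < t with hG
  have h3 : 2 * t ≤ G.card := by omega
  calc ((2 * t * t : ℕ) : ℝ≥0∞) ≤ ((G.card * t : ℕ) : ℝ≥0∞) := by
        exact_mod_cast Nat.mul_le_mul_right t h3
    _ = G.card • (t : ℝ≥0∞) := by rw [nsmul_eq_mul]; push_cast; rfl
    _ ≤ ∑ U ∈ G, ((alg.numQueries (hardInstance e i h U) (D U) : ℕ∞) : ℝ≥0∞) := by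
        refine Finset.card_nsmul_le_sum _ _ _ fun U hU => ?_
        have := not_lt.1 (Finset.mem_filter.1 hU).2
        have h4 := ENat.toENNReal_le.2 this
        simpa using h4
    _ ≤ _ := Finset.sum_le_sum_of_subset (Finset.filter_subset _ _)

end Oracles

/-! ### Averaging over the hidden sets -/

/-- Numerical comparison behind the base `5/4`: `(8/5) ^ 8 > 32`. -/
theorem mul_pow_lt_mul_pow {n : ℕ} (hn : 8 ≤ n) :
    ((4 * 2 ^ (n - 4) : ℕ) : ℝ≥0∞) * (5 / 4) ^ n < ((2 * 2 ^ (n - 4) * 2 ^ (n - 4) : ℕ) : ℝ≥0∞) := by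
  obtain ⟨k, rfl⟩ := Nat.exists_eq_add_of_le hn
  have hk : 8 + k - 4 = 4 + k := by omega
  rw [hk]
  have h1 : (4 * 2 ^ (4 + k) : ℝ) * (5 / 4) ^ (8 + k) < 2 * 2 ^ (4 + k) * 2 ^ (4 + k) := by
    have h2 : ((5 : ℝ) / 4) ^ k ≤ 2 ^ k := by gcongr; norm_num
    have h3 : (0 : ℝ) < 2 ^ k := by positivity
    rw [pow_add, pow_add]
    nlinarith [mul_pos h3 h3, mul_le_mul_of_nonneg_left h2 h3.le]
  have h4 : (4 * 2 ^ (4 + k) : ℝ≥0) * (5 / 4) ^ (8 + k) < 2 * 2 ^ (4 + k) * 2 ^ (4 + k) := by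
    exact_mod_cast h1
  have h5 : ((5 : ℝ≥0∞) / 4) = ((5 / 4 : ℝ≥0) : ℝ≥0∞) := by
    rw [ENNReal.coe_div (by norm_num)]; norm_num
  rw [h5]
  exact_mod_cast h4

end Inspection

/-- A randomized algorithm is a family of deterministic ones, indexed by the outcome `ω` of its
internal randomness; a deterministic algorithm is the case of a one-point `Ω`. -/
theorem theorem3 :
    ∃ n₀ : ℕ, ∀ (A : Type*) [Fintype A] [DecidableEq A], n₀ ≤ Fintype.card A →
      ∀ (Ω : Type*) [MeasurableSpace Ω] (μ : MeasureTheory.Measure Ω)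
        [MeasureTheory.IsProbabilityMeasure μ] (alg : Ω → Inspection.QueryAlgorithm A),
      (∀ (I : Inspection.Instance A) (D : (A → ℝ≥0) → Finset A),
        Inspection.XOS I.v → Inspection.IsDemandOracle I.v D →
        AEMeasurable (fun ω => ((alg ω).numQueries I D : ℝ≥0∞)) μ ∧
        ∀ᵐ ω ∂μ, (alg ω).Solves I D) →
      ∃ (I : Inspection.Instance A) (D : (A → ℝ≥0) → Finset A),
        Inspection.XOS I.v ∧ Inspection.IsDemandOracle I.v D ∧
        (5 / 4 : ℝ≥0∞) ^ Fintype.card A ≤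
          ∫⁻ ω, ((alg ω).numQueries I D : ℝ≥0∞) ∂μ := by
  refine ⟨8, fun A _ _ hn Ω _ μ _ alg halg => ?_⟩
  obtain ⟨e, i, hei⟩ := Fintype.exists_pair_of_one_lt_card (by omega : 1 < Fintype.card A)
  obtain ⟨D₀, hD₀⟩ :=
    Inspection.exists_isDemandOracle (Inspection.hardInstance e i hei Finset.univ).v
  choose D hD hanswer using Inspection.exists_hidden_oracle e i hei hD₀
  set n := Fintype.card A with hn_def
  set F : Finset (Finset A) := Finset.Icc {e} (Finset.univ.erase i) with hF_def
  have hF : ∀ U ∈ F, e ∈ U ∧ i ∉ U := by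
    intro U hU
    obtain ⟨h1, h2⟩ := Finset.mem_Icc.1 hU
    exact ⟨h1 (Finset.mem_singleton_self e), fun h => Finset.notMem_erase i _ (h2 h)⟩
  have hcard : F.card = 4 * 2 ^ (n - 4) := by
    have hsub : {e} ⊆ Finset.univ.erase i := by simpa using hei
    rw [hF_def, Finset.card_Icc_finset hsub, Finset.card_erase_of_mem (Finset.mem_univ i),
      Finset.card_univ, Finset.card_singleton, ← hn_def,
      show n - 1 - 1 = 2 + (n - 4) by omega, pow_add]
    norm_num
  have ht : 2 ≤ 2 ^ (n - 4) := by
    calc 2 = 2 ^ 1 := rfl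
      _ ≤ 2 ^ (n - 4) := Nat.pow_le_pow_right (by norm_num) (by omega)
  have hall := fun U => halg _ (D U) (Inspection.hardInstance_xos e i hei U) (hD U)
  by_contra! hcon
  have hlt : ∀ U ∈ F, ∫⁻ ω, ((alg ω).numQueries (Inspection.hardInstance e i hei U) (D U) : ℝ≥0∞) ∂μ
      ≤ (5 / 4 : ℝ≥0∞) ^ n := fun U _ =>
    (hcon _ (D U) (Inspection.hardInstance_xos e i hei U) (hD U)).le
  have hsolve : ∀ᵐ ω ∂μ, ∀ U, (alg ω).Solves (Inspection.hardInstance e i hei U) (D U) :=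
    MeasureTheory.ae_all_iff.2 fun U => (hall U).2
  have hupper := Finset.sum_le_card_nsmul F _ _ hlt
  rw [← MeasureTheory.lintegral_finsetSum' F fun U _ => (hall U).1, hcard, nsmul_eq_mul] at hupper
  have hlower : ((2 * 2 ^ (n - 4) * 2 ^ (n - 4) : ℕ) : ℝ≥0∞) ≤
      ∫⁻ ω, ∑ U ∈ F,
        ((alg ω).numQueries (Inspection.hardInstance e i hei U) (D U) : ℝ≥0∞) ∂μ := by
    calc ((2 * 2 ^ (n - 4) * 2 ^ (n - 4) : ℕ) : ℝ≥0∞)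
        = ∫⁻ _, ((2 * 2 ^ (n - 4) * 2 ^ (n - 4) : ℕ) : ℝ≥0∞) ∂μ := by simp
      _ ≤ _ := by
        refine MeasureTheory.lintegral_mono_ae ?_
        filter_upwards [hsolve] with ω hω
        exact (alg ω).le_sum_numQueries hei hanswer hF (fun U _ => hω U) ht hcard
  exact absurd (hlower.trans hupper) (not_le.2 (Inspection.mul_pow_lt_mul_pow hn))
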